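/- A JB$^*$-triple is a complex Banach space $E$ with a continuous triple product $\{a,b,c\}$ that is linear in $a$ and $c$, symmetric in $a$ and $c$, conjugate linear in $b$, and satisfies, with $L(a,b)z=\{a,b,z\}$: (a) $L(x,y)\{a,b,c\}=\{L(x,y)a,b,c\}-\{a,L(y,x)b,c\}+\{a,b,L(x,y)c\}$ for all $x,y,a,b,c\in E$; (b) for each $x\in E$ the operator $L(x,x)$ is hermitian (that is, $\exp(itL(x,x))$ is an isometry for every $t\in\mathbb{R}$) and has non-negative spectrum; (c) $\|\{x,x,x\}\|=\|x\|^3$ for all $x\in E$. A JB$^*$-subtriple of $E$ is a norm-closed linear subspace that is closed under the triple product. A linear subspace $F$ of $E$ is a Čebyšëv subspace if for each $x\in E$ there is a unique $p\in F$ with $\operatorname{dist}(x,F)=\|x-p\|$. Elements $x,y\in E$ are orthogonal, written $x\perp y$, if $L(x,y)=0$, and $M_E^\perp=\{y\in E: y\perp x \text{ for all } x\in M\}$ for $M\subseteq E$. Proposition. Let $E$ be a JB$^*$-triple, let $F$ be a JB$^*$-subtriple of $E$ that is a Čebyšëv subspace of $E$, and let $a\in F$ be non-zero. Then $\{a\}_E^\perp=\{x\in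 E: x\perp a\}\subseteq F$. -/

import Mathlib

/-- A bounded linear operator `T` on a complex normed space is hermitian if `exp (i t T)` is an
isometry for every real `t`. -/
def IsHermitianOperator {E : Type*} [NormedAddCommGroup E] [NormedSpace ℂ E]
    (T : E →L[ℂ] E) : Prop :=
  ∀ (t : ℝ) (x : E), ‖NormedSpace.exp ((Complex.I * (t : ℂ)) • T) x‖ = ‖x‖

/-- A JB*-triple: a complex Banach space with a continuous triple product
`{a, b, c} = triple a b c`, linear in `a` and `c`, conjugate linear in `b` and symmetric in
`a` and `c`. The operator `L(a, b)` is `triple a b : E →L[ℂ] E`. -/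
class JBStarTriple (E : Type*) [NormedAddCommGroup E] [NormedSpace ℂ E] [CompleteSpace E] where
  /-- The triple product. -/
  triple : E →L[ℂ] E →L⋆[ℂ] E →L[ℂ] E
  triple_symm : ∀ a b c : E, triple a b c = triple c b a
  jordan_identity : ∀ x y a b c : E,
    triple x y (triple a b c) =
      triple (triple x y a) b c - triple a (triple y x b) c + triple a b (triple x y c)
  isHermitianOperator : ∀ x : E, IsHermitianOperator (triple x x)
  spectrum_nonneg : ∀ x : E, ∀ z ∈ spectrum ℂ (triple x x), 0 ≤ z.re ∧ z.im = 0
  norm_triple_self : ∀ x : E, ‖triple x x x‖ = ‖x‖ ^ 3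

namespace JBStarTriple

variable {E : Type*} [NormedAddCommGroup E] [NormedSpace ℂ E] [CompleteSpace E] [JBStarTriple E]

/-- The operator `L(a, b) : z ↦ {a, b, z}`. -/
noncomputable def L (a b : E) : E →L[ℂ] E := triple a b

/-- `a ⊥ b` means `L(a, b) = 0`. -/
def Orthogonal (a b : E) : Prop := L a b = 0

/-- The orthogonal annihilator of a subset `M` of `E`. -/
def annihilator (M : Set E) : Set E := {y | ∀ x ∈ M, Orthogonal y x}

/-- A JB*-subtriple: a norm-closed linear subspace that is closed under the triple product. -/
structure IsSubtriple (F : Submodule ℂ E) : Prop where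
  isClosed : IsClosed (F : Set E)
  triple_mem : ∀ {a b c : E}, a ∈ F → b ∈ F → c ∈ F → triple a b c ∈ F

end JBStarTriple

/-- A Chebyshev subspace: every point of `X` has exactly one best approximation in `V`. -/
def IsChebyshevSubspace {X : Type*} [NormedAddCommGroup X] [NormedSpace ℂ X]
    (V : Submodule ℂ X) : Prop :=
  ∀ x : X, ∃! p : X, p ∈ V ∧ Metric.infDist x (V : Set X) = ‖x - p‖

/-! If `x ⊥ a`, then `L(a, a) x = 0`. The operators `exp (-t L(a, a))`, `t ≥ 0`, are contractions
(`norm_exp_neg_smul_apply_le`) fixing `x` and preserving `F`, so uniqueness makes them fix the best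
approximation `p`; hence `y = x - p` is also killed by `L(a, a)`. For such `y` and a multiple `b` of
a high odd power of `a`, all mixed triple products vanish: the Jordan identity handles some,
Liouville's theorem with contractivity the others. Iterated cubing is then additive on `y + b`, and
`‖{z, z, z}‖ = ‖z‖ ^ 3` forces `‖y + b‖ ≤ ‖y‖` whenever `‖b‖ ≤ ‖y‖` (`norm_add_smul_oddPow_le`). If
`y ≠ 0`, some `b ≠ 0` qualifies, and `p - b` is a second best approximation. -/

open Filter Topology in
theorem norm_exp_mul_le_of_spectralRadius {B : Type*} [NormedRing B] [NormedAlgebra ℂ B]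
    [CompleteSpace B] (R : B) (r : ℝ) (hr : 0 ≤ r)
    (hR : spectralRadius ℂ R ≤ ENNReal.ofReal r) (ε : ℝ) (hε : 0 < ε) :
    ∃ C : ℝ, ∀ t : ℝ, 0 ≤ t → ‖NormedSpace.exp ((t : ℂ) • R)‖ ≤ C * Real.exp (t * (r + ε)) := by
  have hlt : spectralRadius ℂ R < ENNReal.ofReal (r + ε) :=
    hR.trans_lt ((ENNReal.ofReal_lt_ofReal_iff (by linarith)).2 (by linarith))
  have hev : ∀ᶠ n : ℕ in atTop, ‖R ^ n‖ ≤ (r + ε) ^ n := by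
    filter_upwards [(spectrum.pow_norm_pow_one_div_tendsto_nhds_spectralRadius R).eventually_lt_const
      hlt, eventually_gt_atTop 0] with n hn hn0
    have h1 : ‖R ^ n‖ ^ (1 / n : ℝ) < r + ε := by
      exact (ENNReal.ofReal_lt_ofReal_iff (by linarith)).1 hn
    have h2 := pow_le_pow_left₀ (by positivity) h1.le n
    rwa [← Real.rpow_natCast, ← Real.rpow_mul (by positivity), one_div,
      inv_mul_cancel₀ (by positivity), Real.rpow_one] at h2
  obtain ⟨C, hC, hb⟩ := Asymptotics.bound_of_isBigO_nat_atTop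
    (Asymptotics.IsBigO.of_bound 1 (f := fun n => R ^ n) (g := fun n => (r + ε) ^ n) (by
      filter_upwards [hev] with n hn
      rw [one_mul]; exact hn.trans (Real.le_norm_self _)))
  have hpos : 0 < r + ε := by linarith
  have hb' : ∀ n, ‖R ^ n‖ ≤ C * (r + ε) ^ n := fun n => by
    have := hb (x := n) (pow_pos hpos n).ne'
    rwa [Real.norm_of_nonneg (pow_nonneg hpos.le n)] at this
  refine ⟨C, fun t ht => ?_⟩
  have hs := NormedSpace.exp_series_hasSum_exp' (𝕂 := ℂ) ((t : ℂ) • R)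
  have hs2 : HasSum (fun n : ℕ => C * ((t * (r + ε)) ^ n / n.factorial))
      (C * Real.exp (t * (r + ε))) := by
    rw [Real.exp_eq_exp_ℝ]
    exact (NormedSpace.expSeries_div_hasSum_exp (t * (r + ε))).mul_left C
  rw [← hs.tsum_eq]
  refine tsum_of_norm_bounded hs2 fun n => ?_
  rw [smul_pow, norm_smul, norm_smul, norm_inv, norm_pow, Complex.norm_real,
    Real.norm_of_nonneg ht, mul_pow, Complex.norm_natCast]
  calc _ ≤ (n.factorial : ℝ)⁻¹ * (t ^ n * (C * (r + ε) ^ n)) := by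
        gcongr; exact hb' n
    _ = _ := by ring

/-! ### Exponentials of hermitian operators. -/

section

variable {E : Type*} [NormedAddCommGroup E] [NormedSpace ℂ E] [CompleteSpace E]

theorem exp_add_of_commute_operator {S T : E →L[ℂ] E} (h : Commute S T) :
    NormedSpace.exp (S + T) = NormedSpace.exp S * NormedSpace.exp T := by
  let _ : NormedAlgebra ℚ (E →L[ℂ] E) := NormedAlgebra.restrictScalars ℚ ℂ _
  exact NormedSpace.exp_add_of_commute h

omit [CompleteSpace E] in
theorem exp_smul_one (c : ℂ) :
    NormedSpace.exp (c • (1 : E →L[ℂ] E)) = Complex.exp c • (1 : E →L[ℂ] E) := by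
  rw [← Algebra.algebraMap_eq_smul_one, ← Algebra.algebraMap_eq_smul_one,
    ← NormedSpace.algebraMap_exp_comm, Complex.exp_eq_exp_ℂ]

theorem continuous_exp_operator : Continuous (NormedSpace.exp : (E →L[ℂ] E) → (E →L[ℂ] E)) := by
  let _ : NormedAlgebra ℚ (E →L[ℂ] E) := NormedAlgebra.restrictScalars ℚ ℂ _
  exact NormedSpace.exp_continuous

theorem exp_apply_of_apply_eq_zero {T : E →L[ℂ] E} {x : E} (h : T x = 0) :
    NormedSpace.exp T x = x := by
  have hs := (NormedSpace.exp_series_hasSum_exp' (𝕂 := ℂ) T).mapL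
    (ContinuousLinearMap.apply ℂ E x)
  refine hs.unique ?_
  convert hasSum_single (α := E) (L := SummationFilter.unconditional ℕ) 0 ?_ using 1
  · simp
  · intro n hn
    obtain ⟨m, rfl⟩ := Nat.exists_eq_succ_of_ne_zero hn
    simp [pow_succ, h]

theorem hasDerivAt_exp_smul_apply (T : E →L[ℂ] E) (x : E) (z : ℂ) :
    HasDerivAt (fun w : ℂ => NormedSpace.exp (w • T) x) (NormedSpace.exp (z • T) (T x)) z := by
  have := (hasDerivAt_exp_smul_const (𝕂 := ℂ) T z).clm_apply (hasDerivAt_const z x)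
  simpa using this

/-- A one-parameter group with a bounded entire orbit has zero derivative along the orbit. -/
theorem apply_eq_zero_of_norm_exp_le {T : E →L[ℂ] E} {x : E} {C : ℝ}
    (h : ∀ z : ℂ, ‖NormedSpace.exp (z • T) x‖ ≤ C) : T x = 0 := by
  have hd : Differentiable ℂ (fun w : ℂ => NormedSpace.exp (w • T) x) :=
    fun z => (hasDerivAt_exp_smul_apply T x z).differentiableAt
  have hb : Bornology.IsBounded (Set.range fun w : ℂ => NormedSpace.exp (w • T) x) :=
    isBounded_iff_forall_norm_le.2 ⟨C, by rintro _ ⟨z, rfl⟩; exact h z⟩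
  have hc : (fun w : ℂ => NormedSpace.exp (w • T) x) = fun _ => NormedSpace.exp ((0 : ℂ) • T) x :=
    funext fun w => hd.apply_eq_apply_of_bounded hb w 0
  have h1 := hasDerivAt_exp_smul_apply T x 0
  rw [hc] at h1
  simpa using h1.unique (hasDerivAt_const _ _)

/-- The spectrum of `H` lies in `[0, r]`, which `w ↦ r - w` preserves. -/
theorem spectralRadius_sub_le {H : E →L[ℂ] E}
    (hs : ∀ z ∈ spectrum ℂ H, 0 ≤ z.re ∧ z.im = 0) {r : ℝ} (hr : ‖H‖ ≤ r) :
    spectralRadius ℂ (algebraMap ℂ (E →L[ℂ] E) r - H) ≤ ENNReal.ofReal r := by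
  refine iSup₂_le fun z hz => ?_
  rw [← spectrum.singleton_sub_eq] at hz
  obtain ⟨_, rfl, w, hw, rfl⟩ := hz
  obtain ⟨h0, h1⟩ := hs w hw
  have hwr : w = (w.re : ℂ) := Complex.ext rfl (by simpa using h1)
  have hle : w.re ≤ r := by
    have : Nontrivial E := by
      by_contra hn
      rw [not_nontrivial_iff_subsingleton] at hn
      have : Subsingleton (E →L[ℂ] E) := inferInstance
      rw [spectrum.of_subsingleton] at hw
      exact hw
    have := spectrum.norm_le_norm_of_mem hw
    exact (Complex.re_le_norm w).trans (this.trans hr)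
  change ((‖(r : ℂ) - w‖₊ : NNReal) : ENNReal) ≤ _
  rw [hwr, ← Complex.ofReal_sub, ← ENNReal.ofReal_coe_nnreal, coe_nnnorm, Complex.norm_real,
    Real.norm_of_nonneg (by linarith)]
  exact ENNReal.ofReal_le_ofReal (by linarith)

theorem norm_exp_apply_le (T : E →L[ℂ] E) (x : E) :
    ‖NormedSpace.exp T x‖ ≤ Real.exp ‖T‖ * ‖x‖ := by
  have hs := (NormedSpace.exp_series_hasSum_exp' (𝕂 := ℂ) T).mapL
    (ContinuousLinearMap.apply ℂ E x)
  have hs2 : HasSum (fun n : ℕ => ‖T‖ ^ n / n.factorial * ‖x‖) (Real.exp ‖T‖ * ‖x‖) := by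
    rw [Real.exp_eq_exp_ℝ]
    exact (NormedSpace.expSeries_div_hasSum_exp ‖T‖).mul_right ‖x‖
  rw [← ContinuousLinearMap.apply_apply (𝕜 := ℂ) x, ← hs.tsum_eq]
  refine tsum_of_norm_bounded hs2 fun n => ?_
  rw [map_smul, norm_smul, norm_inv, Complex.norm_natCast, ContinuousLinearMap.apply_apply,
    div_eq_inv_mul, mul_assoc]
  gcongr
  induction n with
  | zero => simp
  | succ n ih =>
    rw [pow_succ', pow_succ', mul_assoc]
    exact (T.le_opNorm _).trans (mul_le_mul_of_nonneg_left ih (norm_nonneg _))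

open Filter Topology Asymptotics in
/-- The semigroup generated by a hermitian operator with non-negative spectrum is contractive. -/
theorem norm_exp_neg_smul_apply_le {H : E →L[ℂ] E} (hH : IsHermitianOperator H)
    (hs : ∀ z ∈ spectrum ℂ H, 0 ≤ z.re ∧ z.im = 0) {z : ℂ} (hz : 0 ≤ z.re) (x : E) :
    ‖NormedSpace.exp (-z • H) x‖ ≤ ‖x‖ := by
  -- The spectral radius allows growth `e^{εt}` on the positive axis; the damping factor absorbs it.
  -- On the imaginary axis the group is isometric, so Phragmén–Lindelöf applies; then `ε → 0`.
  have key : ∀ ε : ℝ, 0 < ε → ‖Complex.exp (-(ε * z)) • NormedSpace.exp (-z • H) x‖ ≤ ‖x‖ := by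
    intro ε hε
    refine PhragmenLindelof.right_half_plane_of_bounded_on_real
      (f := fun z : ℂ => Complex.exp (-(ε * z)) • NormedSpace.exp (-z • H) x) ?_ ?_ ?_ ?_ hz
    · refine Differentiable.diffContOnCl ?_
      refine Differentiable.smul (by fun_prop) ?_
      have hd : Differentiable ℂ fun w : ℂ => NormedSpace.exp (w • H) x :=
        fun w => (hasDerivAt_exp_smul_apply H x w).differentiableAt
      exact hd.comp (f := fun w : ℂ => -w) differentiable_id.neg
    · refine ⟨1, by norm_num, ε + ‖H‖, ?_⟩
      refine IsBigO.of_bound ‖x‖ (Eventually.of_forall fun w => ?_)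
      rw [norm_smul, Complex.norm_exp, Real.rpow_one, Real.norm_of_nonneg (Real.exp_pos _).le,
        add_mul, Real.exp_add]
      have h1 : (-(ε * w)).re ≤ ε * ‖w‖ := by
        refine (Complex.re_le_norm _).trans ?_
        rw [norm_neg, norm_mul, Complex.norm_real, Real.norm_of_nonneg hε.le]
      have h2 : ‖NormedSpace.exp (-w • H) x‖ ≤ Real.exp (‖H‖ * ‖w‖) * ‖x‖ := by
        have := norm_exp_apply_le (-w • H) x
        rwa [norm_smul, norm_neg, mul_comm ‖w‖] at this
      calc _ ≤ Real.exp (ε * ‖w‖) * (Real.exp (‖H‖ * ‖w‖) * ‖x‖) := by gcongr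
        _ = _ := by ring
    · obtain ⟨C, hC⟩ := norm_exp_mul_le_of_spectralRadius _ ‖H‖ (norm_nonneg _)
        (spectralRadius_sub_le hs le_rfl) ε hε
      refine ⟨C * ‖x‖, ?_⟩
      rw [eventually_map]
      filter_upwards [eventually_ge_atTop 0] with t ht
      have h1 : -(t : ℂ) • H = (-(t * ‖H‖ : ℂ)) • (1 : E →L[ℂ] E) +
          (t : ℂ) • (algebraMap ℂ (E →L[ℂ] E) ‖H‖ - H) := by
        rw [Algebra.algebraMap_eq_smul_one]
        module
      have h2 : Complex.exp (-(ε * t)) • NormedSpace.exp (-(t : ℂ) • H) x =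
          (Real.exp (-(t * (‖H‖ + ε))) : ℂ) •
            NormedSpace.exp ((t : ℂ) • (algebraMap ℂ (E →L[ℂ] E) ‖H‖ - H)) x := by
        rw [h1, exp_add_of_commute_operator ((Commute.one_left _).smul_left _), exp_smul_one,
          mul_apply_eq_comp, smul_apply, one_apply_eq_self, smul_smul, ← Complex.exp_add]
        push_cast
        congr 2
        ring
      rw [h2, norm_smul, Complex.norm_real, Real.norm_of_nonneg (Real.exp_pos _).le]
      calc _ ≤ Real.exp (-(t * (‖H‖ + ε))) * (C * Real.exp (t * (‖H‖ + ε)) * ‖x‖) := by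
            gcongr
            exact (ContinuousLinearMap.le_opNorm _ _).trans (by gcongr; exact hC t ht)
        _ = C * ‖x‖ * (Real.exp (-(t * (‖H‖ + ε))) * Real.exp (t * (‖H‖ + ε))) := by ring
        _ = C * ‖x‖ := by rw [← Real.exp_add]; simp
    · intro t
      rw [norm_smul, Complex.norm_exp]
      have := hH (-t) x
      have h2 : (Complex.I * ((-t : ℝ) : ℂ)) = -(t * Complex.I) := by push_cast; ring
      rw [h2] at this
      rw [this]
      simp
  have hlim : Tendsto (fun ε : ℝ => ‖Complex.exp (-(ε * z)) • NormedSpace.exp (-z • H) x‖)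
      (𝓝[>] 0) (𝓝 ‖Complex.exp (-((0 : ℝ) * z)) • NormedSpace.exp (-z • H) x‖) :=
    (Continuous.tendsto (by fun_prop) (0 : ℝ)).mono_left nhdsWithin_le_nhds
  have := le_of_tendsto hlim (eventually_nhdsWithin_of_forall fun ε hε => key ε hε)
  simpa using this

end

/-! ### Odd powers of one element. -/

namespace JBStarTriple

variable {E : Type*} [NormedAddCommGroup E] [NormedSpace ℂ E] [CompleteSpace E] [JBStarTriple E]

theorem triple_bracket (x y a b : E) :
    triple x y * triple a b - triple a b * triple x y =
      triple (triple x y a) b - triple a (triple y x b) := by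
  ext c
  have := jordan_identity x y a b c
  simp only [sub_apply, mul_apply_eq_comp, this]
  abel

/-- The odd powers `a, {a, a, a}, {a, a, {a, a, a}}, …` of an element. -/
noncomputable def oddPow (a : E) (n : ℕ) : E := (triple a a ^ n) a

@[simp] theorem oddPow_zero (a : E) : oddPow a 0 = a := rfl

theorem oddPow_succ (a : E) (n : ℕ) : oddPow a (n + 1) = triple a a (oddPow a n) := by
  simp [oddPow, pow_succ']

theorem bracket_triple_oddPow (a : E) (k l : ℕ) :
    triple a a * triple (oddPow a k) (oddPow a l) - triple (oddPow a k) (oddPow a l) * triple a a =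
      triple (oddPow a (k + 1)) (oddPow a l) - triple (oddPow a k) (oddPow a (l + 1)) := by
  rw [triple_bracket, ← oddPow_succ, ← oddPow_succ]

/-- At level `n + 1` the operators form an arithmetic progression in `k` with step the commutator
`D`. Expanding `-D` by the other bracket formula gives `(n + 1) • D`, so `D = 0`. -/
theorem triple_oddPow_eq (a : E) (n : ℕ) :
    ∀ k l, k + l = n → triple (oddPow a k) (oddPow a l) = triple (oddPow a n) a := by
  induction n with
  | zero =>
    intro k l h
    obtain ⟨rfl, rfl⟩ : k = 0 ∧ l = 0 := by omega
    rfl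
  | succ n ih =>
    set D := triple a a * triple (oddPow a n) a - triple (oddPow a n) a * triple a a with hD
    have hstep : ∀ k l, k + l = n →
        triple (oddPow a (k + 1)) (oddPow a l) = triple (oddPow a k) (oddPow a (l + 1)) + D := by
      intro k l h
      have := bracket_triple_oddPow a k l
      rw [ih k l h, ← hD] at this
      rw [this]; abel
    have hprog : ∀ k l, k + l = n + 1 →
        triple (oddPow a k) (oddPow a l) = triple a (oddPow a (n + 1)) + (k : ℂ) • D := by
      intro k
      induction k with
      | zero =>
        intro l h
        obtain rfl : l = n + 1 := by omega
        simp
      | succ k ihk =>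
        intro l h
        rw [hstep k l (by omega), ihk (l + 1) (by omega)]
        push_cast
        module
    have h1 : -D = triple (oddPow a (n + 1)) a - triple a (oddPow a (n + 1)) := by
      have h2 := triple_bracket (oddPow a n) a a a
      have h3 : triple a (oddPow a n) a = oddPow a (n + 1) := by
        have := ih 0 n (by omega)
        rw [oddPow_zero] at this
        rw [this, triple_symm, oddPow_succ]
      rw [triple_symm (oddPow a n), ← oddPow_succ, h3] at h2
      rw [← h2, hD]; abel
    have h4 := hprog (n + 1) 0 (by omega)
    rw [oddPow_zero] at h4
    have h5 : ((n : ℂ) + 2) • D = 0 := by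
      rw [h4] at h1
      push_cast at h1
      have h6 : ((n : ℂ) + 2) • D = (triple a (oddPow a (n + 1)) + ((n : ℂ) + 1) • D -
          triple a (oddPow a (n + 1))) - -D := by module
      rw [h6, ← h1, sub_self]
    have h6 : D = 0 := (smul_eq_zero.1 h5).resolve_left (by norm_cast)
    intro k l h
    rw [hprog k l h, h4, h6]
    simp

theorem commute_triple_oddPow (a : E) (n : ℕ) :
    Commute (triple a a) (triple (oddPow a n) a) := by
  have := bracket_triple_oddPow a n 0
  rw [triple_oddPow_eq a (n + 1) n (0 + 1) (by omega), oddPow_zero, sub_self] at this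
  exact sub_eq_zero.1 this

theorem triple_oddPow (a : E) (i j k : ℕ) :
    triple (oddPow a i) (oddPow a j) (oddPow a k) = oddPow a (i + j + k + 1) := by
  rw [triple_oddPow_eq a (i + j) i j rfl]
  induction k with
  | zero => rw [oddPow_zero, triple_symm, ← oddPow_succ]
  | succ k ih =>
    rw [oddPow_succ, ← mul_apply_eq_comp, ← (commute_triple_oddPow a (i + j)).eq,
      mul_apply_eq_comp, ih, ← oddPow_succ]
    rfl

open Filter Topology in
/-- Elements killed by `L(a, a)` are killed by `L(b, c)` for all odd powers `b`, `c` of `a`. -/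
theorem triple_oddPow_apply_eq_zero {a y : E} (h : triple a a y = 0) (i j : ℕ) :
    triple (oddPow a i) (oddPow a j) y = 0 := by
  rw [triple_oddPow_eq a (i + j) i j rfl]
  generalize i + j = k
  set M := triple (oddPow a k) a
  set N := triple (oddPow a (k + k)) a
  -- Perturbing `a` isolates `M` to first order, since `exp` of `L(a, a)` fixes `y`. Taking `s` of
  -- sign opposite to `z.re` and letting `s → 0` bounds the orbit of `y` under `M` on all of `ℂ`.
  have hsum : ∀ s : ℝ, triple (a + (s : ℂ) • oddPow a k) (a + (s : ℂ) • oddPow a k) =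
      triple a a + (2 * s : ℂ) • (M + (s / 2 : ℂ) • N) := by
    intro s
    have h1 := triple_oddPow_eq a k 0 k (by omega)
    have h2 := triple_oddPow_eq a (k + k) k k rfl
    rw [oddPow_zero] at h1
    simp only [map_add, add_apply, map_smul, smul_apply, ContinuousLinearMap.map_smulₛₗ,
      Complex.conj_ofReal, h1, h2]
    module
  have hbound : ∀ (z : ℂ) (s : ℝ), s ≠ 0 → 0 ≤ -z.re / s →
      ‖NormedSpace.exp (z • (M + (s / 2 : ℂ) • N)) y‖ ≤ ‖y‖ := by
    intro z s hs0 hs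
    have hs0' : (s : ℂ) ≠ 0 := by exact_mod_cast hs0
    have h1 := norm_exp_neg_smul_apply_le
      (isHermitianOperator (a + (s : ℂ) • oddPow a k))
      (spectrum_nonneg (a + (s : ℂ) • oddPow a k)) (z := -z / (2 * s : ℝ)) (by
        rw [Complex.div_ofReal_re, Complex.neg_re, mul_comm, ← div_div]
        positivity) y
    have h2 : -(-z / (2 * s : ℝ)) • triple (a + (s : ℂ) • oddPow a k) (a + (s : ℂ) • oddPow a k) =
        z • (M + (s / 2 : ℂ) • N) + (z / (2 * s)) • triple a a := by
      rw [hsum, smul_add, smul_smul, add_comm]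
      push_cast
      congr 2 <;> field_simp
    rw [h2, exp_add_of_commute_operator, mul_apply_eq_comp,
      exp_apply_of_apply_eq_zero (T := (z / (2 * s)) • triple a a)] at h1
    · exact h1
    · rw [smul_apply, h, smul_zero]
    · have c1 := (commute_triple_oddPow a k).symm
      have c2 := (commute_triple_oddPow a (k + k)).symm
      exact ((c1.add_left (c2.smul_left _)).smul_left _).smul_right _
  refine apply_eq_zero_of_norm_exp_le (C := ‖y‖) fun z => ?_
  have hlim : Tendsto (fun s : ℝ => ‖NormedSpace.exp (z • (M + (s / 2 : ℂ) • N)) y‖) (𝓝 0)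
      (𝓝 ‖NormedSpace.exp (z • M) y‖) := by
    have hc : Continuous (fun s : ℝ => ‖NormedSpace.exp (z • (M + (s / 2 : ℂ) • N)) y‖) := by
      refine Continuous.norm (Continuous.clm_apply (continuous_exp_operator.comp ?_)
        continuous_const)
      fun_prop
    simpa using hc.tendsto 0
  rcases le_total z.re 0 with hz | hz
  · refine le_of_tendsto (hlim.mono_left nhdsWithin_le_nhds)
      (eventually_nhdsWithin_of_forall (s := Set.Ioi 0) fun s hs => hbound z s (ne_of_gt hs)
        (div_nonneg (by linarith) (le_of_lt hs)))
  · refine le_of_tendsto (hlim.mono_left nhdsWithin_le_nhds)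
      (eventually_nhdsWithin_of_forall (s := Set.Iio 0) fun s hs => hbound z s (ne_of_lt hs)
        (div_nonneg_of_nonpos (by linarith) (le_of_lt hs)))

/-! ### Mixed products of odd powers with the kernel of `L(a, a)`. -/

theorem triple_apply_triple_of_middle {a x y z : E} (hy : triple a a y = 0) :
    triple a a (triple x y z) = triple (triple a a x) y z + triple x y (triple a a z) := by
  rw [jordan_identity, hy]; simp

theorem triple_apply_triple_of_outer {a x y z : E} (hx : triple a a x = 0)
    (hz : triple a a z = 0) :
    triple a a (triple x y z) = -triple x (triple a a y) z := by
  rw [jordan_identity, hx, hz]; simp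

theorem triple_oddPow_middle_step {a y : E} (h : triple a a y = 0) (i j k : ℕ) :
    triple (oddPow a i) y (oddPow a (j + k + 1)) =
      triple (oddPow a k) a (triple (oddPow a i) y (oddPow a j)) +
        triple (oddPow a j) a (triple (oddPow a i) y (oddPow a k)) := by
  have h1 := jordan_identity (oddPow a i) y (oddPow a j) a (oddPow a k)
  have h2 : triple y (oddPow a i) a = 0 := by
    rw [triple_symm]; exact triple_oddPow_apply_eq_zero h 0 i
  have h3 := triple_oddPow a j 0 k
  rw [oddPow_zero, add_zero] at h3
  rw [h3, h2, triple_symm _ a (oddPow a k)] at h1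
  simpa using h1

theorem triple_oddPow_middle_succ {a y : E} (h : triple a a y = 0) (i j : ℕ) :
    triple a a (triple (oddPow a i) y (oddPow a j)) =
      triple (oddPow a (i + 1)) y (oddPow a j) + triple (oddPow a i) y (oddPow a (j + 1)) := by
  rw [triple_apply_triple_of_middle h, ← oddPow_succ, ← oddPow_succ]

/-- With `w = L(a, a) {a, y, a}`, one expansion gives `{a, y, oddPow a 1} = 2w`, the other `w = 2
{a, y, oddPow a 1}`; hence `3w = 0`. -/
theorem triple_self_triple_middle_eq_zero {a y : E} (h : triple a a y = 0) :
    triple a a (triple a y a) = 0 := by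
  have h1 := triple_oddPow_middle_step h 0 0 0
  have h2 := triple_oddPow_middle_succ h 0 0
  have h3 := triple_symm (oddPow a 1) y a
  simp only [oddPow_zero, zero_add] at h1 h2 h3
  rw [h3, h1] at h2
  have h4 : (3 : ℂ) • triple a a (triple a y a) = 0 := by
    set w := triple a a (triple a y a)
    have : (3 : ℂ) • w = (w + w + (w + w)) - w := by module
    rw [this, ← h2, sub_self]
  exact (smul_eq_zero.1 h4).resolve_left (by norm_num)

theorem triple_oddPow_middle_eq_zero {a y : E} (h : triple a a y = 0) (i j : ℕ) :
    triple (oddPow a i) y (oddPow a (j + 1)) = 0 := by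
  induction i generalizing j with
  | zero =>
    have hw := triple_self_triple_middle_eq_zero h
    induction j with
    | zero =>
      have h1 := triple_oddPow_middle_step h 0 0 0
      simp only [oddPow_zero, zero_add, hw] at h1 ⊢
      simpa using h1
    | succ j ih =>
      have h1 := triple_oddPow_middle_step h 0 (j + 1) 0
      have h2 := triple_oddPow_apply_eq_zero hw (j + 1) 0
      rw [ih] at h1
      simp only [oddPow_zero] at h1 h2 ⊢
      rw [add_zero, h2] at h1
      simpa using h1
  | succ i ih =>
    have h1 := triple_oddPow_middle_succ h i (j + 1)
    rw [ih, ih, map_zero, add_zero] at h1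
    exact h1.symm

theorem triple_oddPow_left_eq_zero {a y v : E} (hy : triple a a y = 0) (hv : triple a a v = 0)
    (i : ℕ) : triple (oddPow a (i + 7)) y v = 0 := by
  have hA : ∀ k, triple a a (triple (oddPow a k) y v) = triple (oddPow a (k + 1)) y v := by
    intro k
    rw [triple_apply_triple_of_middle hy, hv, ← oddPow_succ]; simp
  have hL : ∀ m k, triple (oddPow a m) a (triple (oddPow a k) y v) =
      triple (oddPow a (k + m + 1)) y v := by
    intro m k
    have h0 : triple a (oddPow a m) y = 0 := triple_oddPow_apply_eq_zero hy 0 m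
    have h1 : triple (oddPow a m) a v = 0 := triple_oddPow_apply_eq_zero hv m 0
    have h2 := triple_oddPow a m 0 k
    rw [oddPow_zero, show m + 0 + k = k + m by omega] at h2
    rw [jordan_identity, h0, h1, h2]; simp
  induction i with
  | succ i ih => rw [add_right_comm, ← hA, ih, map_zero]
  | zero =>
    -- Let `X = {oddPow a 7, y, v}`. Since `{c, u, c} = 0`, the Jordan identity for `L(u, c) {c, c,
    -- c}` reads `X = X + X`; this is the source of the 7.
    set c := oddPow a 1 with hc
    set u := triple c y v with hu
    have hccv : triple c v c = 0 := triple_oddPow_middle_eq_zero hv 1 0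
    have hycc : triple y c c = 0 := by
      rw [triple_symm]; exact triple_oddPow_apply_eq_zero hy 1 1
    have hcuc : triple c u c = 0 := by
      have := jordan_identity y c c v c
      rw [hccv, hycc, triple_symm c v] at this
      simpa using this
    have hcc : triple c c = triple (oddPow a 2) a := triple_oddPow_eq a 2 1 1 rfl
    have h3 : triple c c c = oddPow a 4 := triple_oddPow a 1 1 1
    have h4 : triple (oddPow a 4) c = triple (oddPow a 5) a := triple_oddPow_eq a 5 4 1 rfl
    have h := jordan_identity u c c c c
    have h5 : triple u c c = triple (oddPow a 4) y v := by
      rw [triple_symm, hcc, hu, hL]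
    have h6 : triple c c (triple (oddPow a 4) y v) = triple (oddPow a 7) y v := by
      rw [hcc, hL]
    have h7 : triple u c (oddPow a 4) = triple (oddPow a 7) y v := by
      rw [triple_symm, h4, hu, hL]
    rw [h3, hcuc, h5, triple_symm _ c c, h6, h7] at h
    simpa using h

theorem exp_smul_triple_outer {a y v : E} (hy : triple a a y = 0) (hv : triple a a v = 0)
    (c : E) (z : ℂ) :
    NormedSpace.exp (z • triple a a) (triple y c v) =
      triple y (NormedSpace.exp (-(starRingEnd ℂ z) • triple a a) c) v := by
  have h1 := (NormedSpace.exp_series_hasSum_exp' (𝕂 := ℂ) (z • triple a a)).mapL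
    (ContinuousLinearMap.apply ℂ E (triple y c v))
  have h2 := ((NormedSpace.exp_series_hasSum_exp' (𝕂 := ℂ)
    (-(starRingEnd ℂ z) • triple a a)).mapL (ContinuousLinearMap.apply ℂ E c)).mapL
    ((ContinuousLinearMap.apply ℂ E v).comp (triple y))
  refine h1.unique ?_
  convert! h2 using 1
  ext n
  simp only [ContinuousLinearMap.apply_apply, ContinuousLinearMap.comp_apply,
    ContinuousLinearMap.map_smulₛₗ, map_inv₀, map_natCast]
  congr 1
  induction n with
  | zero => simp
  | succ n ih =>
    rw [pow_succ', pow_succ', mul_apply_eq_comp, mul_apply_eq_comp, ih]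
    simp [triple_apply_triple_of_outer hy hv]

/-- The orbit of `{y, a, v}` under `exp (z L(a, a))` is bounded for `z.re ≤ 0` by contractivity, and
for `z.re ≥ 0` because the flow moves to the middle slot with exponent `-conj z`. Liouville
finishes. -/
theorem triple_oddPow_outer_eq_zero {a y v : E} (hy : triple a a y = 0) (hv : triple a a v = 0)
    (i : ℕ) : triple y (oddPow a (i + 1)) v = 0 := by
  induction i with
  | succ i ih =>
    rw [oddPow_succ, ← neg_eq_zero, ← triple_apply_triple_of_outer hy hv, ih, map_zero]
  | zero =>
    rw [zero_add, oddPow_succ, oddPow_zero, ← neg_eq_zero, ← triple_apply_triple_of_outer hy hv]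
    have hcontr : ∀ z : ℂ, z.re ≤ 0 → ∀ x : E, ‖NormedSpace.exp (z • triple a a) x‖ ≤ ‖x‖ := by
      intro z hz x
      have := norm_exp_neg_smul_apply_le (isHermitianOperator a) (spectrum_nonneg a)
        (z := -z) (by simpa using hz) x
      rwa [neg_neg] at this
    refine apply_eq_zero_of_norm_exp_le (C := ‖triple y‖ * ‖a‖ * ‖v‖) fun z => ?_
    have hle : ∀ c : E, ‖c‖ ≤ ‖a‖ → ‖triple y c v‖ ≤ ‖triple y‖ * ‖a‖ * ‖v‖ := fun c hc =>
      ((triple y).le_opNorm₂ c v).trans (by gcongr)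
    rcases le_total z.re 0 with hz | hz
    · exact (hcontr z hz _).trans (hle a le_rfl)
    · rw [exp_smul_triple_outer hy hv]
      exact hle _ (hcontr _ (by simpa using hz) _)

/-! ### Iterated cubes and the norm estimate. -/

/-- The cube `{z, z, z}`. -/
noncomputable def cube (z : E) : E := triple z z z

theorem norm_cube_iterate (z : E) (n : ℕ) : ‖cube^[n] z‖ = ‖z‖ ^ 3 ^ n := by
  induction n with
  | zero => simp
  | succ n ih =>
    rw [Function.iterate_succ_apply', cube, norm_triple_self, ih, ← pow_mul, pow_succ]

theorem triple_apply_cube_eq_zero {a y : E} (h : triple a a y = 0) : triple a a (cube y) = 0 := by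
  rw [cube, triple_apply_triple_of_middle h, h]; simp

theorem cube_smul_oddPow (a : E) (s : ℂ) (i : ℕ) :
    ∃ t : ℂ, cube (s • oddPow a i) = t • oddPow a (i + i + i + 1) := by
  refine ⟨s * (s * starRingEnd ℂ s), ?_⟩
  simp only [cube, map_smul, smul_apply, ContinuousLinearMap.map_smulₛₗ, triple_oddPow, smul_smul]

theorem cube_add {y b : E} (h1 : triple b b y = 0) (h2 : triple b y b = 0)
    (h3 : triple y b y = 0) (h4 : triple b y y = 0) : cube (y + b) = cube y + cube b := by
  have h5 : triple y b b = 0 := by rw [triple_symm, h1]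
  have h6 : triple y y b = 0 := by rw [triple_symm, h4]
  simp only [cube, map_add, add_apply, h1, h2, h3, h4, h5, h6]
  abel

theorem cube_add_smul_oddPow {a y : E} (h : triple a a y = 0) (s : ℂ) (i : ℕ) :
    cube (y + s • oddPow a (i + 7)) = cube y + cube (s • oddPow a (i + 7)) := by
  apply cube_add
  · simp [triple_oddPow_apply_eq_zero h]
  · simp [triple_oddPow_middle_eq_zero h (i + 7) (i + 6)]
  · simp [triple_oddPow_outer_eq_zero h h (i + 6)]
  · simp [triple_oddPow_left_eq_zero h h i]

theorem cube_iterate_add_smul_oddPow (a : E) (n : ℕ) :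
    ∀ (y : E), triple a a y = 0 → ∀ (s : ℂ) (i : ℕ),
      cube^[n] (y + s • oddPow a (i + 7)) = cube^[n] y + cube^[n] (s • oddPow a (i + 7)) := by
  induction n with
  | zero => intros; rfl
  | succ n ih =>
    intro y h s i
    obtain ⟨t, ht⟩ := cube_smul_oddPow a s (i + 7)
    simp only [Function.iterate_succ_apply]
    rw [cube_add_smul_oddPow h, ht,
      -- Cubing keeps the index at least 7, so the induction hypothesis applies.
      show i + 7 + (i + 7) + (i + 7) + 1 = (3 * i + 15) + 7 by ring]
    exact ih _ (triple_apply_cube_eq_zero h) t _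

open Filter in
/-- If `L(a, a) y = 0` then adding to `y` a small multiple of a high odd power of `a` does not
increase the norm. -/
theorem norm_add_smul_oddPow_le {a y : E} (h : triple a a y = 0) (s : ℂ) (i : ℕ)
    (hs : ‖s • oddPow a (i + 7)‖ ≤ ‖y‖) : ‖y + s • oddPow a (i + 7)‖ ≤ ‖y‖ := by
  set b := s • oddPow a (i + 7) with hb
  by_contra! hlt
  have hpow : ∀ n : ℕ, ‖y + b‖ ^ 3 ^ n ≤ 2 * ‖y‖ ^ 3 ^ n := by
    intro n
    rw [← norm_cube_iterate, hb, cube_iterate_add_smul_oddPow a n y h, ← hb]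
    refine (norm_add_le _ _).trans ?_
    rw [norm_cube_iterate, norm_cube_iterate, two_mul]
    gcongr
  have hy : 0 < ‖y‖ := by
    refine (norm_nonneg y).lt_of_ne fun h0 => ?_
    have hb0 : b = 0 := norm_le_zero_iff.1 (hs.trans h0.ge)
    rw [hb0, add_zero] at hlt
    exact lt_irrefl _ hlt
  have hr : 1 < ‖y + b‖ / ‖y‖ := (one_lt_div hy).2 hlt
  have ht := (tendsto_pow_atTop_atTop_of_one_lt hr).comp
    (tendsto_pow_atTop_atTop_of_one_lt (r := 3) (by norm_num))
  obtain ⟨n, hn⟩ := (ht.eventually_gt_atTop 2).exists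
  simp only [Function.comp_apply, div_pow] at hn
  rw [lt_div_iff₀ (by positivity)] at hn
  exact absurd (hpow n) (not_le.2 hn)

/-! ### Best approximation in a Chebyshev subtriple. -/

theorem oddPow_mem {F : Submodule ℂ E} (hF : IsSubtriple F) {a : E} (ha : a ∈ F) (n : ℕ) :
    oddPow a n ∈ F := by
  induction n with
  | zero => exact ha
  | succ n ih => rw [oddPow_succ]; exact hF.triple_mem ha ha ih

/-- Cubing sends index `i` to `3i + 1` and preserves being non-zero; in `0, 1, 4, 13` the last is
the first index at least 7. -/
theorem oddPow_thirteen_ne_zero {a : E} (ha : a ≠ 0) : oddPow a 13 ≠ 0 := by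
  have h : ∀ i, oddPow a i ≠ 0 → oddPow a (i + i + i + 1) ≠ 0 := by
    intro i hi
    rw [← triple_oddPow, ← norm_ne_zero_iff, norm_triple_self]
    exact pow_ne_zero _ (norm_ne_zero_iff.2 hi)
  exact h 4 (h 1 (h 0 ha))

theorem exp_smul_triple_mem {F : Submodule ℂ E} (hF : IsSubtriple F) {a p : E} (ha : a ∈ F)
    (hp : p ∈ F) (z : ℂ) : NormedSpace.exp (z • triple a a) p ∈ F := by
  have h1 := (NormedSpace.exp_series_hasSum_exp' (𝕂 := ℂ) (z • triple a a)).mapL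
    (ContinuousLinearMap.apply ℂ E p)
  refine hF.isClosed.mem_of_tendsto h1 (Filter.Eventually.of_forall fun s => ?_)
  refine F.sum_mem fun n _ => ?_
  rw [map_smul, ContinuousLinearMap.apply_apply]
  refine F.smul_mem _ ?_
  clear * - hF ha hp
  induction n with
  | zero => exact hp
  | succ n ih =>
    rw [pow_succ', mul_apply_eq_comp]
    exact F.smul_mem _ (hF.triple_mem ha ha ih)

/-- The best approximation in a Chebyshev subtriple containing `a` of an element killed by
`L(a, a)` is itself killed by `L(a, a)`. -/
theorem triple_apply_bestApproximation {F : Submodule ℂ E} (hF : IsSubtriple F)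
    (hC : IsChebyshevSubspace F) {a x p : E} (ha : a ∈ F) (hx : triple a a x = 0) (hp : p ∈ F)
    (hd : Metric.infDist x (F : Set E) = ‖x - p‖) : triple a a p = 0 := by
  have hfix : ∀ t : ℝ, 0 ≤ t → NormedSpace.exp ((-t : ℂ) • triple a a) p = p := by
    intro t ht
    have hmem := exp_smul_triple_mem hF ha hp (-t : ℂ)
    refine (hC x).unique ⟨hmem, le_antisymm ?_ ?_⟩ ⟨hp, hd⟩
    · rw [← dist_eq_norm]; exact Metric.infDist_le_dist_of_mem hmem
    · have hxe : NormedSpace.exp ((-t : ℂ) • triple a a) x = x :=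
        exp_apply_of_apply_eq_zero (by rw [smul_apply, hx, smul_zero])
      have := norm_exp_neg_smul_apply_le (isHermitianOperator a) (spectrum_nonneg a)
        (z := t) (by simpa using ht) (x - p)
      rwa [map_sub, hxe, ← hd] at this
  -- `p` is known to be fixed only for non-positive times, so the derivative is taken at the
  -- interior point `-1`; the invertible factor `exp T` is then cancelled.
  have h1 := (hasDerivAt_exp_smul_apply (triple a a) p ((-1 : ℝ) : ℂ)).scomp (-1 : ℝ)
    Complex.ofRealCLM.hasDerivAt
  rw [Complex.ofRealCLM_apply, Complex.ofReal_one, one_smul] at h1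
  have h2 : (fun t : ℝ => NormedSpace.exp ((t : ℂ) • triple a a) p) =ᶠ[nhds (-1)] fun _ => p := by
    filter_upwards [Iio_mem_nhds (show (-1 : ℝ) < 0 by norm_num)] with t ht
    have := hfix (-t) (by linarith [Set.mem_Iio.1 ht])
    simpa using this
  have h3 := h1.unique ((hasDerivAt_const (-1 : ℝ) p).congr_of_eventuallyEq h2)
  set T := ((-1 : ℝ) : ℂ) • triple a a with hT
  have h4 : (NormedSpace.exp (-T) * NormedSpace.exp T) (triple a a p) = triple a a p := by
    rw [← exp_add_of_commute_operator ((Commute.refl T).neg_left), neg_add_cancel,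
      NormedSpace.exp_zero, one_apply_eq_self]
  rw [← h4, mul_apply_eq_comp, h3, map_zero]

end JBStarTriple

theorem mainTheorem8 {E : Type*} [NormedAddCommGroup E] [NormedSpace ℂ E] [CompleteSpace E]
    [JBStarTriple E] (F : Submodule ℂ E) (hF : JBStarTriple.IsSubtriple F)
    (hC : IsChebyshevSubspace F) (a : E) (haF : a ∈ F) (ha : a ≠ 0) :
    JBStarTriple.annihilator {a} = {x : E | JBStarTriple.Orthogonal x a} ∧
      {x : E | JBStarTriple.Orthogonal x a} ⊆ (F : Set E) := by
  refine ⟨by ext; simp [JBStarTriple.annihilator], fun x hx => ?_⟩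
  have hx0 : JBStarTriple.triple a a x = 0 := by
    have h : JBStarTriple.triple x a = 0 := hx
    rw [JBStarTriple.triple_symm, h]; simp
  obtain ⟨p, ⟨hp, hd⟩, huniq⟩ := hC x
  have hp0 := JBStarTriple.triple_apply_bestApproximation hF hC haF hx0 hp hd
  by_contra hxF
  have hy : 0 < ‖x - p‖ := by
    rw [norm_pos_iff, sub_ne_zero]
    rintro rfl
    exact hxF hp
  have hc := JBStarTriple.oddPow_thirteen_ne_zero ha
  have hcn : 0 < ‖JBStarTriple.oddPow a 13‖ := norm_pos_iff.2 hc
  -- Scaled so that `s • oddPow a 13` has norm exactly `‖x - p‖`.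
  set s : ℂ := ((‖x - p‖ / ‖JBStarTriple.oddPow a 13‖ : ℝ) : ℂ) with hs
  have hs0 : s ≠ 0 := by
    rw [hs, Complex.ofReal_ne_zero]; positivity
  have hle := JBStarTriple.norm_add_smul_oddPow_le (a := a) (y := x - p)
    (by rw [map_sub, hx0, hp0, sub_zero]) s 6 (by
      rw [norm_smul, hs, Complex.norm_real, Real.norm_of_nonneg (by positivity),
        div_mul_cancel₀ _ hcn.ne'])
  have hmem : p - s • JBStarTriple.oddPow a 13 ∈ F :=
    F.sub_mem hp (F.smul_mem _ (JBStarTriple.oddPow_mem hF haF 13))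
  have heq := huniq _ ⟨hmem, le_antisymm
    (by rw [← dist_eq_norm]; exact Metric.infDist_le_dist_of_mem hmem)
    (by rw [hd, show x - (p - s • JBStarTriple.oddPow a 13) =
          x - p + s • JBStarTriple.oddPow a (6 + 7) by abel_nf]
        exact hle)⟩
  exact smul_ne_zero hs0 hc (by simpa using heq)
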